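/- Let $L\in\{1,2,\dots\}$ and widths $p_0=d,p_1,\dots,p_L\ge 1$, $p_{L+1}=1$ be given, let $P:=\sum_{l=0}^{L}p_{l+1}p_l$, and let $\mathcal A$ be the set of all $\Omega=(U^L,\dots,U^0)$ with $U^l\in\mathbb R^{p_{l+1}\times p_l}$. For activation functions $f^l:\mathbb R^{p_l}\to\mathbb R^{p_l}$, $l=1,\dots,L$, define the networks $g_\Omega:\mathbb R^d\to\mathbb R$, $g_\Omega(x):=U^Lf^L(\cdots U^1f^1(U^0x))$, and let $\mathcal A_1:=\{\Omega\in\mathcal A:\sum_{l=0}^{L}\sum_{k=1}^{p_{l+1}}\sum_{j=1}^{p_l}|U^l_{kj}|\le 1\}$. Assume that the activations satisfy $f^l(0)=0$ and are $a_{\mathrm{Lip}}$-Lipschitz with respect to the Euclidean norms, for some $a_{\mathrm{Lip}}\in[0,\infty)$. Let $x_1,\dots,x_n\in\mathbb R^d$ be fixed, let $g_*:\mathbb R^d\to\mathbb R$ be any function, and let $y_i=g_*(x_i)+u_i$, $i=1,\dots,n$, where the noise variables $u_1,\dots,u_n$ are independent, centered, and satisfy $\max_{i}K^2\bigl(\mathbb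 E e^{|u_i|^2/K^2}-1\bigr)\le\gamma^2$ for constants $K,\gamma\in(0,\infty)$. Write $\|x\|_n:=\sqrt{\sum_{i=1}^n\|x_i\|^2/n}$ and $$\operatorname{err}(\kappa g_\Omega):=\sqrt{\frac1n\sum_{i=1}^n\bigl(\kappa g_\Omega(x_i)-g_*(x_i)\bigr)^2}.$$ **Theorem 2 (Prediction guarantee for $\ell_1$-regularization).** There are a constant $a\in(0,\infty)$ and a threshold $N\in\mathbb N$ that depend only on $K$ and $\gamma$ such that the following holds in the above setting whenever $n\ge N$. If $$\lambda\ \ge\ a\Bigl(\frac{2a_{\mathrm{Lip}}}{L}\Bigr)^L\|x\|_n\sqrt{L\log(2P)}\,\frac{\log(2n)}{\sqrt n},$$ then with probability at least $1-1/n$, every solution $$(\hat\kappa,\hat\Omega)\in\operatorname*{arg\,min}_{\kappa\in[0,\infty),\,\Omega\in\mathcal A_1}\Bigl\{\frac1n\sum_{i=1}^n\bigl(y_i-\kappa g_\Omega(x_i)\bigr)^2+\lambda\kappa\Bigr\}$$ satisfies $$\operatorname{err}^2(\hat\kappa g_{\hat\Omega})\ \le\ \inf_{\kappa\in[0,\infty),\,\Omega\in\mathcal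 A_1}\bigl\{\operatorname{err}^2(\kappa g_\Omega)+2\lambda\kappa\bigr\}.$$ -/

import Mathlib

open MeasureTheory ProbabilityTheory

noncomputable section

namespace ScaleReg

/-- A feedforward architecture with `L ≥ 1` hidden layers and widths `p 0, …, p (L + 1) ≥ 1`,
where `p 0` is the input dimension and the output layer has width one.
Values `p l` with `l > L + 1` play no role. -/
structure Architecture where
  L : ℕ
  one_le_L : 1 ≤ L
  p : ℕ → ℕ
  p_pos : ∀ l, l ≤ L + 1 → 1 ≤ p l
  p_out : p (L + 1) = 1

namespace Architecture

variable (A : Architecture)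

/-- The Euclidean space `ℝ^{p l}` of the `l`th layer. -/
abbrev Layer (l : ℕ) : Type := EuclideanSpace ℝ (Fin (A.p l))

/-- Total number of parameters `P = ∑_{l=0}^{L} p_{l+1} p_l`. -/
def numParams : ℕ := ∑ l ∈ Finset.range (A.L + 1), A.p (l + 1) * A.p l

/-- Parameters: one weight matrix `W l ∈ ℝ^{p (l+1) × p l}` for each `l = 0, …, L`. -/
abbrev Param : Type := ∀ l : Fin (A.L + 1), Matrix (Fin (A.p (l + 1))) (Fin (A.p l)) ℝ

/-- Activation functions `f l : ℝ^{p l} → ℝ^{p l}`; only those with `1 ≤ l ≤ L` are used. -/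
abbrev Activations : Type := ∀ l : ℕ, A.Layer l → A.Layer l

variable {A}

/-- Output of the `l`th layer, `l = 0, …, L`: the input `x` for `l = 0`,
and `f l (W (l-1) z)` with `z` the output of the layer before for `1 ≤ l ≤ L`. -/
def hidden (f : A.Activations) (W : A.Param) (x : A.Layer 0) :
    (l : ℕ) → l ≤ A.L → A.Layer l
  | 0, _ => x
  | l + 1, h =>
      f (l + 1) (WithLp.toLp 2
        (Matrix.mulVec (W ⟨l, by omega⟩) (WithLp.ofLp (hidden f W x l (by omega)))))

/-- The network `g_W(x) = W^L f^L(⋯ W^1 f^1(W^0 x))`, which is the single coordinate of a vector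
in `ℝ^{p (L+1)} = ℝ^1`. -/
def net (f : A.Activations) (W : A.Param) (x : A.Layer 0) : ℝ :=
  Matrix.mulVec (W (Fin.last A.L)) (WithLp.ofLp (hidden f W x A.L le_rfl))
    ⟨0, A.p_pos (A.L + 1) le_rfl⟩

/-- The `ℓ₁`-norm of the parameters: the sum of the absolute values of all entries. -/
def l1Norm (W : A.Param) : ℝ := ∑ l, ∑ k, ∑ j, |W l k j|

/-- The `ℓ₁` unit ball of the parameter space. -/
def unitBall (A : Architecture) : Set A.Param := {W | l1Norm W ≤ 1}

/-- The activations of the hidden layers vanish at the origin and are `c`-Lipschitz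
with respect to the Euclidean norms. -/
def LipschitzActivations (f : A.Activations) (c : ℝ) : Prop :=
  ∀ l, 1 ≤ l → l ≤ A.L → f l 0 = 0 ∧ ∀ z z' : A.Layer l, ‖f l z - f l z'‖ ≤ c * ‖z - z'‖

/-- The pairs of a scale `κ ≥ 0` and an orientation in the `ℓ₁` unit ball. -/
def scaleSpace (A : Architecture) : Set (ℝ × A.Param) := {q | 0 ≤ q.1 ∧ q.2 ∈ A.unitBall}

/-- The scaled network `κ g_W`. -/
def scaledNet (f : A.Activations) (q : ℝ × A.Param) (x : A.Layer 0) : ℝ := q.1 * net f q.2 x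

/-- The scale-regularized least-squares objective. -/
def objective {n : ℕ} (f : A.Activations) (x : Fin n → A.Layer 0) (y : Fin n → ℝ) (lam : ℝ)
    (q : ℝ × A.Param) : ℝ :=
  1 / (n : ℝ) * ∑ i, (y i - scaledNet f q (x i)) ^ 2 + lam * q.1

/-- `q` is a (global) solution of the scale-regularized least-squares problem over
`[0, ∞) × (ℓ₁ unit ball)`. -/
def IsEstimate {n : ℕ} (f : A.Activations) (x : Fin n → A.Layer 0) (y : Fin n → ℝ) (lam : ℝ)
    (q : ℝ × A.Param) : Prop :=
  q ∈ A.scaleSpace ∧ IsMinOn (objective f x y lam) A.scaleSpace q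

/-- The in-sample prediction error of a function `h` with respect to `gstar`. -/
def predErr {n : ℕ} (x : Fin n → A.Layer 0) (gstar h : A.Layer 0 → ℝ) : ℝ :=
  √(1 / (n : ℝ) * ∑ i, (h (x i) - gstar (x i)) ^ 2)

/-- `‖x‖_n = √(∑ ‖x_i‖² / n)`. -/
def dataNorm {n : ℕ} (x : Fin n → A.Layer 0) : ℝ := √((∑ i, ‖x i‖ ^ 2) / (n : ℝ))

end Architecture

/-- Independent, centered noise variables that are uniformly sub-Gaussian with constants `K, γ`:
`max_i K² (𝔼 exp(|u_i|² / K²) - 1) ≤ γ²`, the expectations being finite. -/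
structure SubGaussianNoise {Ω : Type*} [MeasurableSpace Ω] (μ : Measure Ω) (K γ : ℝ) {n : ℕ}
    (u : Fin n → Ω → ℝ) : Prop where
  measurable : ∀ i, Measurable (u i)
  indep : iIndepFun u μ
  centered : ∀ i, ∫ ω, u i ω ∂μ = 0
  integrable_exp : ∀ i, Integrable (fun ω => Real.exp (|u i ω| ^ 2 / K ^ 2)) μ
  bound : ∀ i, K ^ 2 * ((∫ ω, Real.exp (|u i ω| ^ 2 / K ^ 2) ∂μ) - 1) ≤ γ ^ 2

end ScaleReg

end

/-!
The noise enters the least-squares objective only through the linear term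
`2 κ / n * ∑ i, u i * net f W (x i)`. On the event that `2 / n * |∑ i, u i * net f W (x i)| ≤ lam`
for every `W` in the `ℓ₁` unit ball, comparing the objective at the estimate with its value at any
other point gives the oracle inequality (`predErr_sq_le_of_isEstimate`). Everything else bounds the
supremum of this empirical process, with the following ingredients.

* The noise is sub-Gaussian with variance proxy `K² + 2 γ²`
  (`hasSubgaussianMGF_of_integral_exp_sq_le`), so that Hoeffding's bound holds in every fixed
  direction, and its Euclidean norm is controlled by Markov's inequality.
* The network is Lipschitz in its parameters over the unit ball
  (`abs_net_sub_le_of_mem_unitBall`): a telescoping sum over the layers leaves out one layer in each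
  product of layer norms, and a product of `L` numbers with sum at most `2` is at most `(2 / L)^L`.
  Cauchy-Schwarz over the `L + 1` layers turns the sum of the layer distances into the Euclidean
  distance of the parameters, at the price of `√(L + 1)`.
* The `ℓ₁` unit ball in dimension `P` has a Euclidean `2 / 2^k`-net with at most `(2 P) ^ (4 ^ k)`
  points, namely averages of `4 ^ k` vertices (`exists_finset_cover_l1Ball`). The choice of vertices
  is greedy, a derandomized form of Maurey's argument.
* Chaining along these nets (`exists_event_abs_sum_le`): the links at scale `k` have length of order
  `2 ^ (-k)` and the logarithm of their number is of order `4 ^ k log (2 P)`, so each scale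
  contributes `√(log (2 P))`. There are about `log n` scales until the radius is below `1 / n`, where
  the Cauchy-Schwarz inequality suffices.
-/

/-! ### Sub-Gaussian noise -/

namespace ScaleReg

lemma exp_le_add_exp_sq (x : ℝ) : Real.exp x ≤ x + Real.exp (x ^ 2) := by
  have h2 := Real.add_one_le_exp (x ^ 2)
  rcases le_total |x| 1 with h | h
  · have := (abs_le.1 (Real.abs_exp_sub_one_sub_id_le h)).2
    linarith
  · rcases le_abs.1 h with h1 | h1
    · have : Real.exp x ≤ Real.exp (x ^ 2) := Real.exp_le_exp.2 (by nlinarith)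
      linarith
    · have : Real.exp x ≤ 1 := Real.exp_le_one_iff.2 (by linarith)
      nlinarith

section Noise

variable {Ω : Type*} [MeasurableSpace Ω] {μ : Measure Ω} [IsProbabilityMeasure μ]

/-- A centered variable whose `ψ₂`-type moment `K² (𝔼 exp (X² / K²) - 1)` is at most `γ²` is
sub-Gaussian with variance proxy `K² + 2 γ²`. -/
lemma hasSubgaussianMGF_of_integral_exp_sq_le {X : Ω → ℝ} {K γ : ℝ} (hK : 0 < K)
    (hX : Measurable X) (h0 : ∫ ω, X ω ∂μ = 0)
    (hint : Integrable (fun ω => Real.exp (|X ω| ^ 2 / K ^ 2)) μ)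
    (hb : K ^ 2 * ((∫ ω, Real.exp (|X ω| ^ 2 / K ^ 2) ∂μ) - 1) ≤ γ ^ 2) :
    HasSubgaussianMGF X (Real.toNNReal (K ^ 2 + 2 * γ ^ 2)) μ := by
  simp only [sq_abs] at hint hb
  set B := ∫ ω, Real.exp (X ω ^ 2 / K ^ 2) ∂μ with hB
  have hK2 : 0 < K ^ 2 := by positivity
  have hXi : Integrable X μ := by
    refine (hint.const_mul K).mono' hX.aestronglyMeasurable (ae_of_all _ fun ω => ?_)
    have h1 := Real.add_one_le_exp (X ω ^ 2 / K ^ 2)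
    have h2 : |X ω| / K ≤ X ω ^ 2 / K ^ 2 + 1 := by
      have : X ω ^ 2 / K ^ 2 = (|X ω| / K) ^ 2 := by rw [div_pow, sq_abs]
      rw [this]; nlinarith [sq_nonneg (|X ω| / K - 1), abs_nonneg (X ω),
        div_nonneg (abs_nonneg (X ω)) hK.le]
    rw [Real.norm_eq_abs, ← div_le_iff₀' hK]
    exact h2.trans h1
  have hpt (t : ℝ) (ω : Ω) : Real.exp (t * X ω) ≤
      Real.exp (t ^ 2 * K ^ 2 / 2) * Real.exp (X ω ^ 2 / K ^ 2) := by
    rw [← Real.exp_add]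
    refine Real.exp_le_exp.2 ?_
    have h1 : (t * K) * (X ω / K) = t * X ω := by field_simp
    have h2 : X ω ^ 2 / K ^ 2 = (X ω / K) ^ 2 := by rw [div_pow]
    rw [← h1, h2]
    nlinarith [sq_nonneg (t * K - X ω / K), sq_nonneg (X ω / K)]
  have hexp (t : ℝ) : Integrable (fun ω => Real.exp (t * X ω)) μ :=
    (hint.const_mul (Real.exp (t ^ 2 * K ^ 2 / 2))).mono'
      (by fun_prop) (ae_of_all _ fun ω => by
        rw [Real.norm_eq_abs, abs_of_pos (Real.exp_pos _)]; exact hpt t ω)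
  have hB1 : B ≤ 1 + γ ^ 2 / K ^ 2 := by
    have := (le_div_iff₀' hK2).2 hb
    linarith
  refine ⟨hexp, fun t => ?_⟩
  rw [Real.coe_toNNReal _ (by positivity), mgf]
  rcases le_total (t ^ 2 * K ^ 2) 1 with ht | ht
  · -- for small `t`, use `exp x ≤ x + exp x²` and convexity of `exp`
    have h1 (ω : Ω) : Real.exp (t * X ω) ≤
        t * X ω + ((1 - t ^ 2 * K ^ 2) + t ^ 2 * K ^ 2 * Real.exp (X ω ^ 2 / K ^ 2)) := by
      refine (exp_le_add_exp_sq _).trans (add_le_add_right ?_ _)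
      have h := convexOn_exp.2 (Set.mem_univ 0) (Set.mem_univ (X ω ^ 2 / K ^ 2))
        (sub_nonneg.2 ht) (by positivity : (0:ℝ) ≤ t ^ 2 * K ^ 2) (by ring)
      simp only [smul_eq_mul, mul_zero, zero_add, Real.exp_zero, mul_one] at h
      convert h using 2
      field_simp
    calc ∫ ω, Real.exp (t * X ω) ∂μ
        ≤ ∫ ω, (t * X ω + ((1 - t ^ 2 * K ^ 2) +
            t ^ 2 * K ^ 2 * Real.exp (X ω ^ 2 / K ^ 2))) ∂μ :=
          integral_mono (hexp t) ((hXi.const_mul t).add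
            ((integrable_const _).add (hint.const_mul _))) h1
      _ = (1 - t ^ 2 * K ^ 2) + t ^ 2 * K ^ 2 * B := by
          have hi : Integrable (fun ω => (1 - t ^ 2 * K ^ 2) +
              t ^ 2 * K ^ 2 * Real.exp (X ω ^ 2 / K ^ 2)) μ :=
            (integrable_const _).add (hint.const_mul _)
          rw [integral_add (hXi.const_mul t) hi,
            integral_add (integrable_const _) (hint.const_mul _), integral_const_mul,
            integral_const_mul, h0]
          simp [hB]
      _ = t ^ 2 * (K ^ 2 * (B - 1)) + 1 := by ring
      _ ≤ t ^ 2 * γ ^ 2 + 1 := by gcongr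
      _ ≤ Real.exp (t ^ 2 * γ ^ 2) := Real.add_one_le_exp _
      _ ≤ _ := Real.exp_le_exp.2 (by nlinarith [sq_nonneg (t * K)])
  · -- for large `t`, split `t X ≤ t² K² / 2 + X² / (2 K²)`
    have h1 (ω : Ω) : Real.exp (t * X ω) ≤
        Real.exp (t ^ 2 * K ^ 2 / 2) * Real.exp (X ω ^ 2 / K ^ 2) := hpt t ω
    have hγ : γ ^ 2 / K ^ 2 ≤ t ^ 2 * γ ^ 2 := by
      rw [div_le_iff₀ hK2]; nlinarith [sq_nonneg γ]
    calc ∫ ω, Real.exp (t * X ω) ∂μ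
        ≤ ∫ ω, Real.exp (t ^ 2 * K ^ 2 / 2) * Real.exp (X ω ^ 2 / K ^ 2) ∂μ :=
          integral_mono (hexp t) (hint.const_mul _) h1
      _ = Real.exp (t ^ 2 * K ^ 2 / 2) * B := by rw [integral_const_mul]
      _ ≤ Real.exp (t ^ 2 * K ^ 2 / 2) * Real.exp (t ^ 2 * γ ^ 2) := by
          gcongr
          linarith [Real.add_one_le_exp (t ^ 2 * γ ^ 2)]
      _ = _ := by rw [← Real.exp_add]; ring_nf

omit [IsProbabilityMeasure μ] in
lemma integrable_sq_of_integrable_exp_sq {X : Ω → ℝ} {K : ℝ} (hK : 0 < K) (hX : Measurable X)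
    (hint : Integrable (fun ω => Real.exp (|X ω| ^ 2 / K ^ 2)) μ) :
    Integrable (fun ω => X ω ^ 2) μ := by
  refine (hint.const_mul (K ^ 2)).mono' (by fun_prop) (ae_of_all _ fun ω => ?_)
  rw [Real.norm_eq_abs, abs_of_nonneg (sq_nonneg _), sq_abs, ← div_le_iff₀' (by positivity)]
  linarith [Real.add_one_le_exp (X ω ^ 2 / K ^ 2)]

lemma integral_sq_le_of_integral_exp_sq_le {X : Ω → ℝ} {K γ : ℝ} (hK : 0 < K) (hX : Measurable X)
    (hint : Integrable (fun ω => Real.exp (|X ω| ^ 2 / K ^ 2)) μ)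
    (hb : K ^ 2 * ((∫ ω, Real.exp (|X ω| ^ 2 / K ^ 2) ∂μ) - 1) ≤ γ ^ 2) :
    ∫ ω, X ω ^ 2 ∂μ ≤ γ ^ 2 := by
  refine le_trans ?_ hb
  have h : ∫ ω, X ω ^ 2 ∂μ ≤ ∫ ω, K ^ 2 * (Real.exp (|X ω| ^ 2 / K ^ 2) - 1) ∂μ := by
    refine integral_mono (integrable_sq_of_integrable_exp_sq hK hX hint)
      ((hint.sub (integrable_const 1)).const_mul _) fun ω => ?_
    simp only [sq_abs]
    rw [← div_le_iff₀' (by positivity)]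
    linarith [Real.add_one_le_exp (X ω ^ 2 / K ^ 2)]
  rwa [integral_const_mul, integral_sub hint (integrable_const 1), integral_const,
    probReal_univ, one_smul] at h

variable {n : ℕ} {u : Fin n → Ω → ℝ}

/-- Two-sided Hoeffding bound for a fixed direction `z`, scaled so that the right-hand side does
not depend on `z`. The strict inequality makes `z = 0` harmless. -/
lemma measureReal_lt_abs_sum_le {c : NNReal} (hind : iIndepFun u μ)
    (hu : ∀ i, HasSubgaussianMGF (u i) c μ) (z : EuclideanSpace ℝ (Fin n)) {t : ℝ} (ht : 0 ≤ t) :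
    μ.real {ω | t * ‖z‖ < |∑ i, u i ω * z i|} ≤ 2 * Real.exp (-t ^ 2 / (2 * c)) := by
  rcases eq_or_ne z 0 with rfl | hz
  · simp; positivity
  have key (s : ℝ) (hs : s ^ 2 = 1) :
      μ.real {ω | t * ‖z‖ ≤ ∑ i, (s * z i) * u i ω} ≤ Real.exp (-t ^ 2 / (2 * c)) := by
    have hi : iIndepFun (fun i ω => (s * z i) * u i ω) μ :=
      hind.comp (fun i r => (s * z i) * r) fun i => by fun_prop
    have h := HasSubgaussianMGF.measure_sum_ge_le_of_iIndepFun hi (s := Finset.univ)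
      (fun i _ => (hu i).const_mul (s * z i)) (ε := t * ‖z‖) (by positivity)
    refine h.trans_eq ?_
    congr 1
    have hsum : ((∑ i : Fin n, (⟨(s * z i) ^ 2, sq_nonneg _⟩ * c : NNReal) : NNReal) : ℝ)
        = ‖z‖ ^ 2 * c := by
      push_cast
      rw [EuclideanSpace.norm_sq_eq, Finset.sum_mul]
      refine Finset.sum_congr rfl fun i _ => ?_
      change (s * z i) ^ 2 * (c : ℝ) = _
      rw [mul_pow, hs, one_mul, Real.norm_eq_abs, sq_abs]
    rw [hsum]
    have : ‖z‖ ^ 2 ≠ 0 := by simpa using hz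
    rw [show -(t * ‖z‖) ^ 2 = ‖z‖ ^ 2 * (-t ^ 2) by ring,
      show 2 * (‖z‖ ^ 2 * (c : ℝ)) = ‖z‖ ^ 2 * (2 * c) by ring, mul_div_mul_left _ _ this]
  calc μ.real {ω | t * ‖z‖ < |∑ i, u i ω * z i|}
      ≤ μ.real ({ω | t * ‖z‖ ≤ ∑ i, (1 * z i) * u i ω} ∪
          {ω | t * ‖z‖ ≤ ∑ i, (-1 * z i) * u i ω}) := by
        refine measureReal_mono (fun ω hω => ?_) (by finiteness)
        have h1 : ∑ i, (1 * z i) * u i ω = ∑ i, u i ω * z i :=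
          Finset.sum_congr rfl fun i _ => by ring
        have h2 : ∑ i, (-1 * z i) * u i ω = -∑ i, u i ω * z i := by
          rw [← Finset.sum_neg_distrib]; exact Finset.sum_congr rfl fun i _ => by ring
        simp only [Set.mem_union, Set.mem_ofPred_eq, h1, h2] at hω ⊢
        exact (lt_abs.1 hω).imp le_of_lt le_of_lt
    _ ≤ _ := (measureReal_union_le _ _).trans
        (by linarith [key 1 (by norm_num), key (-1) (by norm_num)])

lemma measureReal_iUnion_lt_abs_sum_le {c : NNReal} (hind : iIndepFun u μ)
    (hu : ∀ i, HasSubgaussianMGF (u i) c μ) (Z : Finset (EuclideanSpace ℝ (Fin n))) {t : ℝ}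
    (ht : 0 ≤ t) :
    μ.real (⋃ z ∈ Z, {ω | t * ‖z‖ < |∑ i, u i ω * z i|})
      ≤ Z.card * (2 * Real.exp (-t ^ 2 / (2 * c))) := by
  refine (measureReal_biUnion_finset_le _ _).trans ?_
  rw [← nsmul_eq_mul]
  exact Finset.sum_le_card_nsmul _ _ _ fun z _ => measureReal_lt_abs_sum_le hind hu z ht

/-- Markov's inequality for the squared Euclidean norm of the noise vector. -/
lemma measureReal_lt_sum_sq_le {v : ℝ} (hint : ∀ i, Integrable (fun ω => u i ω ^ 2) μ)
    (hv : ∀ i, ∫ ω, u i ω ^ 2 ∂μ ≤ v) {r : ℝ} (hr : 0 < r) :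
    μ.real {ω | r < ∑ i, u i ω ^ 2} ≤ n * v / r := by
  have h := mul_meas_ge_le_integral_of_nonneg (μ := μ) (f := fun ω => ∑ i, u i ω ^ 2)
    (ae_of_all _ fun ω => Finset.sum_nonneg fun i _ => sq_nonneg _)
    (integrable_finsetSum _ fun i _ => hint i) r
  rw [integral_finsetSum _ fun i _ => hint i] at h
  have h2 : ∑ i, ∫ ω, u i ω ^ 2 ∂μ ≤ n * v := by
    simpa using Finset.sum_le_card_nsmul Finset.univ _ _ fun i _ => hv i
  rw [le_div_iff₀' hr]
  refine le_trans ?_ (h.trans h2)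
  refine mul_le_mul_of_nonneg_left (measureReal_mono ?_ (by finiteness)) hr.le
  intro ω hω
  rw [Set.mem_ofPred_eq] at hω ⊢
  exact hω.le

end Noise

end ScaleReg

/-! ### Nets of the `ℓ₁` ball -/

namespace ScaleReg

section Covering

variable {ι : Type*} [Fintype ι]

/-- The `ℓ₁` unit ball, inside the Euclidean space so that distances are Euclidean. -/
def l1Ball (ι : Type*) [Fintype ι] : Set (EuclideanSpace ℝ ι) := {θ | ∑ i, |θ i| ≤ 1}

lemma zero_mem_l1Ball : (0 : EuclideanSpace ℝ ι) ∈ l1Ball ι := by simp [l1Ball]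

lemma norm_le_sum_abs (θ : EuclideanSpace ℝ ι) : ‖θ‖ ≤ ∑ i, |θ i| := by
  refine le_of_sq_le_sq ?_ (Finset.sum_nonneg fun i _ => abs_nonneg _)
  rw [EuclideanSpace.norm_sq_eq]
  exact Finset.sum_sq_le_sq_sum_of_nonneg fun i _ => abs_nonneg _

lemma norm_le_one_of_mem_l1Ball {θ : EuclideanSpace ℝ ι} (h : θ ∈ l1Ball ι) : ‖θ‖ ≤ 1 :=
  (norm_le_sum_abs θ).trans h

variable [DecidableEq ι]

/-- The vertices `± e_i` of the `ℓ₁` ball. -/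
noncomputable def l1Vertex (v : ι × Bool) : EuclideanSpace ℝ ι :=
  EuclideanSpace.single v.1 (if v.2 then 1 else -1)

lemma l1Vertex_mem (v : ι × Bool) : l1Vertex v ∈ l1Ball ι := by
  obtain ⟨i, b⟩ := v
  cases b <;> simp [l1Vertex, l1Ball, apply_ite abs]

/-- The average of `m` vertices; for `m = 0` it is the origin, still a point of the ball. -/
noncomputable def l1Average {m : ℕ} (v : Fin m → ι × Bool) : EuclideanSpace ℝ ι :=
  (m : ℝ)⁻¹ • ∑ k, l1Vertex (v k)

lemma l1Average_mem {m : ℕ} (v : Fin m → ι × Bool) : l1Average v ∈ l1Ball ι := by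
  have h (i : ι) : |l1Average v i| ≤ (m : ℝ)⁻¹ * ∑ k, |l1Vertex (v k) i| := by
    rw [l1Average, PiLp.smul_apply, smul_eq_mul, abs_mul, abs_of_nonneg (by positivity)]
    gcongr
    rw [WithLp.ofLp_sum, Finset.sum_apply]
    exact Finset.abs_sum_le_sum_abs _ _
  refine (Finset.sum_le_sum fun i _ => h i).trans ?_
  rw [← Finset.mul_sum, Finset.sum_comm]
  have : ∑ k, ∑ i, |l1Vertex (v k) i| ≤ m := by
    simpa using Finset.sum_le_card_nsmul Finset.univ (fun k => ∑ i, |l1Vertex (v k) i|) 1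
      fun k _ => l1Vertex_mem (v k)
  exact (mul_le_mul_of_nonneg_left this (by positivity)).trans inv_mul_le_one

/-- A linear functional attains its minimum over the `ℓ₁` ball at a vertex. -/
lemma exists_inner_l1Vertex_le [Nonempty ι] (w : EuclideanSpace ℝ ι) {θ : EuclideanSpace ℝ ι}
    (hθ : θ ∈ l1Ball ι) : ∃ v, inner ℝ w (l1Vertex v) ≤ inner ℝ w θ := by
  obtain ⟨j, hj⟩ := Finite.exists_max fun i => |w i|
  refine ⟨(j, decide (w j ≤ 0)), ?_⟩
  have h1 : inner ℝ w (l1Vertex (j, decide (w j ≤ 0))) = -|w j| := by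
    rw [l1Vertex, EuclideanSpace.inner_single_right]
    by_cases h : w j ≤ 0
    · simp [h, abs_of_nonpos]
    · simp [h, abs_of_pos (not_le.1 h)]
  have h2 : |inner ℝ w θ| ≤ |w j| := by
    rw [PiLp.inner_apply]
    calc |∑ i, inner ℝ (w i) (θ i)| ≤ ∑ i, |w j| * |θ i| := by
          refine (Finset.abs_sum_le_sum_abs _ _).trans (Finset.sum_le_sum fun i _ => ?_)
          rw [RCLike.inner_apply, conj_trivial, mul_comm, abs_mul]
          exact mul_le_mul_of_nonneg_right (hj i) (abs_nonneg _)
      _ ≤ |w j| := by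
          rw [← Finset.mul_sum]
          exact mul_le_of_le_one_right (abs_nonneg _) hθ
  rw [h1]
  exact (abs_le.1 h2).1

/-- Maurey's lemma, by greedy selection: with each vertex chosen so that its inner product with
the current error is at most that of `θ`, the squared error of the sum grows linearly. -/
lemma exists_norm_sum_l1Vertex_sub_sq_le [Nonempty ι] {θ : EuclideanSpace ℝ ι}
    (hθ : θ ∈ l1Ball ι) (m : ℕ) :
    ∃ v : Fin m → ι × Bool, ‖∑ k, l1Vertex (v k) - (m : ℝ) • θ‖ ^ 2 ≤ 4 * m := by
  induction m with
  | zero => exact ⟨Fin.elim0, by simp⟩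
  | succ m ih =>
    obtain ⟨v, hv⟩ := ih
    set w := ∑ k, l1Vertex (v k) - (m : ℝ) • θ with hw
    obtain ⟨a, ha⟩ := exists_inner_l1Vertex_le w hθ
    refine ⟨Fin.snoc v a, ?_⟩
    have h1 : ∑ k, l1Vertex ((Fin.snoc v a : Fin (m + 1) → ι × Bool) k) - ((m + 1 : ℕ) : ℝ) • θ
        = w + (l1Vertex a - θ) := by
      rw [Fin.sum_univ_castSucc, hw]
      simp only [Fin.snoc_castSucc, Fin.snoc_last]
      push_cast
      module
    have h2 : ‖l1Vertex a - θ‖ ≤ 2 := by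
      have := norm_sub_le (l1Vertex a) θ
      have := norm_le_one_of_mem_l1Ball (l1Vertex_mem a)
      have := norm_le_one_of_mem_l1Ball hθ
      linarith
    rw [h1, norm_add_sq_real, inner_sub_right]
    push_cast
    nlinarith [norm_nonneg (l1Vertex a - θ)]

/-- The covering number of the `ℓ₁` ball at radius `2 / r` with `m = r²` is at most
`(2 card ι) ^ m`. -/
lemma exists_finset_cover_l1Ball [Nonempty ι] {m : ℕ} {r : ℝ} (hr : 0 < r) (hm : (m : ℝ) = r ^ 2) :
    ∃ N : Finset (EuclideanSpace ℝ ι), N.card ≤ (2 * Fintype.card ι) ^ m ∧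
      (∀ θ ∈ N, θ ∈ l1Ball ι) ∧ ∀ θ ∈ l1Ball ι, ∃ θ' ∈ N, ‖θ - θ'‖ ≤ 2 / r := by
  classical
  refine ⟨Finset.univ.image (l1Average (ι := ι) (m := m)), ?_, ?_, fun θ hθ => ?_⟩
  · refine Finset.card_image_le.trans_eq ?_
    simp [mul_comm]
  · simp only [Finset.mem_image, Finset.mem_univ, true_and, forall_exists_index,
      forall_apply_eq_imp_iff]
    exact l1Average_mem
  · obtain ⟨v, hv⟩ := exists_norm_sum_l1Vertex_sub_sq_le hθ m
    refine ⟨l1Average v, Finset.mem_image_of_mem _ (Finset.mem_univ _), ?_⟩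
    have hm0 : (m : ℝ) ≠ 0 := by rw [hm]; positivity
    have h1 : θ - l1Average v = -((m : ℝ)⁻¹ • (∑ k, l1Vertex (v k) - (m : ℝ) • θ)) := by
      rw [l1Average, smul_sub, smul_smul, inv_mul_cancel₀ hm0, one_smul, neg_sub]
    have h2 : ‖∑ k, l1Vertex (v k) - (m : ℝ) • θ‖ ≤ 2 * r :=
      le_of_sq_le_sq (by rw [hm] at hv; rw [hm]; linarith) (by positivity)
    rw [h1, norm_neg, norm_smul, Real.norm_eq_abs, abs_of_nonneg (by positivity), hm]
    calc (r ^ 2)⁻¹ * _ ≤ (r ^ 2)⁻¹ * (2 * r) := by rw [← hm]; gcongr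
      _ = 2 / r := by field_simp

end Covering

end ScaleReg

/-! ### Chaining over the `ℓ₁` ball -/

namespace ScaleReg

section Chaining

/-- Deterministic part of the chaining argument: `θ` is reached from `0` along approximations
`π k` in the nets `N k`, and `φ` is controlled on every link of the chain. -/
lemma abs_apply_le_of_chain {E F : Type*} [SeminormedAddCommGroup E] [SeminormedAddCommGroup F]
    {G : E → F} {B : Set E} {M R : ℝ} {N : ℕ → Finset E} {t : ℕ → ℝ} {κ : ℕ} (φ : F →+ ℝ)
    (hR : 0 ≤ R) (hM : 0 ≤ M) (ht : ∀ k, 0 ≤ t k)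
    (hG : ∀ θ ∈ B, ∀ θ' ∈ B, ‖G θ - G θ'‖ ≤ M * ‖θ - θ'‖) (hG0 : G 0 = 0)
    (hN0 : N 0 = {0}) (hNB : ∀ k, ∀ θ ∈ N k, θ ∈ B)
    (hN : ∀ k, ∀ θ ∈ B, ∃ θ' ∈ N k, ‖θ - θ'‖ ≤ 2 / 2 ^ k)
    (hlink : ∀ k < κ, ∀ θ ∈ N k, ∀ θ' ∈ N (k + 1), |φ (G θ' - G θ)| ≤ t k * ‖G θ' - G θ‖)
    (hφ : ∀ z, |φ z| ≤ R * ‖z‖) {θ : E} (hθ : θ ∈ B) :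
    |φ (G θ)| ≤ M * (∑ k ∈ Finset.range κ, t k * (3 / 2 ^ k) + R * (2 / 2 ^ κ)) := by
  choose π hπN hπ using fun k => hN k θ hθ
  have h0 : π 0 = 0 := by simpa [hN0] using hπN 0
  have hstep (k : ℕ) (hk : k < κ) :
      |φ (G (π (k + 1))) - φ (G (π k))| ≤ M * (t k * (3 / 2 ^ k)) := by
    rw [← map_sub]
    have hd : ‖π (k + 1) - π k‖ ≤ 3 / 2 ^ k := by
      calc ‖π (k + 1) - π k‖ = ‖(θ - π k) - (θ - π (k + 1))‖ := by congr 1; abel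
        _ ≤ 2 / 2 ^ k + 2 / 2 ^ (k + 1) := (norm_sub_le _ _).trans (add_le_add (hπ _) (hπ _))
        _ = 3 / 2 ^ k := by field_simp; ring
    calc _ ≤ _ := hlink k hk _ (hπN k) _ (hπN (k + 1))
      _ ≤ t k * (M * (3 / 2 ^ k)) := by
          refine mul_le_mul_of_nonneg_left ?_ (ht k)
          exact (hG _ (hNB _ _ (hπN _)) _ (hNB _ _ (hπN _))).trans
            (mul_le_mul_of_nonneg_left hd hM)
      _ = _ := by ring
  have hsum : |φ (G (π κ))| ≤ M * ∑ k ∈ Finset.range κ, t k * (3 / 2 ^ k) := by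
    have h := Finset.sum_range_sub (fun k => φ (G (π k))) κ
    simp only [h0, hG0, map_zero, sub_zero] at h
    rw [← h, Finset.mul_sum]
    exact (Finset.abs_sum_le_sum_abs _ _).trans
      (Finset.sum_le_sum fun k hk => hstep k (Finset.mem_range.1 hk))
  have hrem : |φ (G θ) - φ (G (π κ))| ≤ M * (R * (2 / 2 ^ κ)) := by
    rw [← map_sub]
    calc _ ≤ R * (M * (2 / 2 ^ κ)) := by
          refine (hφ _).trans (mul_le_mul_of_nonneg_left ?_ hR)
          exact (hG _ hθ _ (hNB _ _ (hπN _))).trans (mul_le_mul_of_nonneg_left (hπ κ) hM)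
      _ = _ := by ring
  have := abs_add_le (φ (G (π κ))) (φ (G θ) - φ (G (π κ)))
  rw [add_sub_cancel] at this
  rw [mul_add]
  linarith

/-- Nets of the `ℓ₁` ball at the dyadic radii, of size exponential in `4 ^ k`. The coarsest net is
replaced by the origin, so that every chain starts where the process vanishes. -/
lemma exists_dyadic_nets (ι : Type*) [Fintype ι] [Nonempty ι] :
    ∃ N : ℕ → Finset (EuclideanSpace ℝ ι), N 0 = {0} ∧
      (∀ k, (N k).card ≤ (2 * Fintype.card ι) ^ 4 ^ k) ∧ (∀ k, ∀ θ ∈ N k, θ ∈ l1Ball ι) ∧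
      ∀ k, ∀ θ ∈ l1Ball ι, ∃ θ' ∈ N k, ‖θ - θ'‖ ≤ 2 / 2 ^ k := by
  classical
  have h (k : ℕ) := exists_finset_cover_l1Ball (ι := ι) (m := 4 ^ k) (r := 2 ^ k) (by positivity)
    (by push_cast; rw [← pow_mul, mul_comm k, pow_mul]; norm_num)
  choose N hc hB hN using h
  refine ⟨fun k => if k = 0 then {0} else N k, rfl, fun k => ?_, fun k => ?_, fun k θ hθ => ?_⟩
  · rcases eq_or_ne k 0 with rfl | hk
    · have := Fintype.card_pos (α := ι)
      simp only [↓reduceIte, Finset.card_singleton, pow_zero, pow_one]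
      omega
    · simpa [hk] using hc k
  · rcases eq_or_ne k 0 with rfl | hk
    · simpa using zero_mem_l1Ball
    · simpa [hk] using hB k
  · rcases eq_or_ne k 0 with rfl | hk
    · have := norm_le_one_of_mem_l1Ball hθ
      exact ⟨0, by simp, by simp; linarith⟩
    · simpa [hk] using hN k θ hθ

lemma one_le_log_two_mul {m : ℝ} (hm : 2 ≤ m) : 1 ≤ Real.log (2 * m) := by
  have h : Real.log (2 ^ 2) ≤ Real.log (2 * m) := Real.log_le_log (by norm_num) (by linarith)
  rw [Real.log_pow] at h
  have := Real.log_two_gt_d9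
  push_cast at h
  linarith

/-- Total length of the chain: each of the logarithmically many scales contributes `√ℓ`, because
the entropy `4 ^ k ℓ` cancels against the squared link length `4 ^ (-k)`. -/
lemma sum_chain_le {c ℓ Λ : ℝ} {κ : ℕ} (hc : 0 ≤ c) (hℓ : 1 ≤ ℓ) (hΛ : 1 ≤ Λ)
    (hκ : (κ : ℝ) ≤ 2 * Λ) :
    ∑ k ∈ Finset.range κ, √(2 * c * (5 * 4 ^ k * ℓ + 2 * Λ)) * (3 / 2 ^ k)
      ≤ 30 * √(2 * c) * (√ℓ * Λ) := by
  have hsℓ : 1 ≤ √ℓ := Real.one_le_sqrt.2 hℓ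
  have hterm (k : ℕ) : √(2 * c * (5 * 4 ^ k * ℓ + 2 * Λ)) * (3 / 2 ^ k)
      ≤ √(2 * c) * (9 * √ℓ + 6 * Λ * (1 / 2) ^ k) := by
    have h4 : (4 : ℝ) ^ k = (2 ^ k) ^ 2 := by rw [← pow_mul, mul_comm k, pow_mul]; norm_num
    have h1 : √(5 * 4 ^ k * ℓ + 2 * Λ) ≤ 3 * 2 ^ k * √ℓ + 2 * Λ := by
      refine Real.sqrt_le_iff.2 ⟨by positivity, ?_⟩
      have h2 : 0 ≤ 3 * 2 ^ k * √ℓ * (2 * Λ) := by positivity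
      have h3 : 0 ≤ (2 ^ k * √ℓ) ^ 2 := by positivity
      have h5 : (2 ^ k * √ℓ) ^ 2 = 4 ^ k * ℓ := by rw [mul_pow, Real.sq_sqrt (by linarith), h4]
      nlinarith
    rw [Real.sqrt_mul (by positivity), mul_assoc]
    refine mul_le_mul_of_nonneg_left ?_ (Real.sqrt_nonneg _)
    calc _ ≤ (3 * 2 ^ k * √ℓ + 2 * Λ) * (3 / 2 ^ k) := by gcongr
      _ = _ := by rw [one_div, inv_pow]; field_simp; ring
  have hgeom : ∑ k ∈ Finset.range κ, ((1 : ℝ) / 2) ^ k ≤ 2 := sum_geometric_two_le κ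
  calc _ ≤ ∑ k ∈ Finset.range κ, √(2 * c) * (9 * √ℓ + 6 * Λ * (1 / 2) ^ k) :=
        Finset.sum_le_sum fun k _ => hterm k
    _ = √(2 * c) * (κ * (9 * √ℓ) + 6 * Λ * ∑ k ∈ Finset.range κ, ((1 : ℝ) / 2) ^ k) := by
        rw [← Finset.mul_sum, Finset.sum_add_distrib, Finset.sum_const, Finset.card_range,
          nsmul_eq_mul, ← Finset.mul_sum]
    _ ≤ √(2 * c) * (2 * Λ * (9 * √ℓ) + 6 * Λ * 2) := by gcongr
    _ ≤ √(2 * c) * (30 * (√ℓ * Λ)) := by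
        refine mul_le_mul_of_nonneg_left ?_ (Real.sqrt_nonneg _)
        nlinarith
    _ = _ := by ring

variable {Ω : Type*} [MeasurableSpace Ω] {μ : Measure Ω} [IsProbabilityMeasure μ]

/-- Uniform deviation bound for a Lipschitz process over the `ℓ₁` ball: with high probability the
supremum is of the order of `√(log (2 P)) log (2 n)`, the Dudley entropy integral of the ball
truncated at radius `1 / n`. -/
lemma exists_event_abs_sum_le {n : ℕ} (hn : 2 ≤ n) {ι : Type*} [Fintype ι]
    (hι : 2 ≤ Fintype.card ι) {u : Fin n → Ω → ℝ} {c : NNReal} {γ : ℝ} (hc : 0 < c) (hγ : 0 < γ)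
    (hmeas : ∀ i, Measurable (u i)) (hind : iIndepFun u μ)
    (hu : ∀ i, HasSubgaussianMGF (u i) c μ) (hint : ∀ i, Integrable (fun ω => u i ω ^ 2) μ)
    (hv : ∀ i, ∫ ω, u i ω ^ 2 ∂μ ≤ γ ^ 2)
    {G : EuclideanSpace ℝ ι → EuclideanSpace ℝ (Fin n)} {M : ℝ} (hM : 0 ≤ M)
    (hG : ∀ θ ∈ l1Ball ι, ∀ θ' ∈ l1Ball ι, ‖G θ - G θ'‖ ≤ M * ‖θ - θ'‖) (hG0 : G 0 = 0) :
    ∃ E : Set Ω, MeasurableSet E ∧ 1 - 1 / (n : ℝ) ≤ μ.real E ∧ ∀ ω ∈ E, ∀ θ ∈ l1Ball ι,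
      |∑ i, u i ω * G θ i| ≤ (30 * √(2 * c) + 4 * γ) * M *
        (√(Real.log (2 * Fintype.card ι)) * Real.log (2 * n)) := by
  classical
  have : Nonempty ι := Fintype.card_pos_iff.1 (by omega)
  obtain ⟨N, hN0, hNcard, hNB, hN⟩ := exists_dyadic_nets ι
  have hn' : (2 : ℝ) ≤ n := by exact_mod_cast hn
  have hP' : (2 : ℝ) ≤ Fintype.card ι := by exact_mod_cast hι
  have hn0 : (0 : ℝ) < n := by linarith
  set ℓ := Real.log (2 * Fintype.card ι)
  set Λ := Real.log (2 * n)
  have hℓ1 : 1 ≤ ℓ := one_le_log_two_mul hP'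
  have hΛ1 : 1 ≤ Λ := one_le_log_two_mul hn'
  have hc' : (0 : ℝ) < c := by exact_mod_cast hc
  -- the finest scale is the first one with `n < 2 ^ κ`
  set κ := Nat.log 2 n + 1 with hκ
  have hκn : κ ≤ n := by
    have h1 : 2 ^ Nat.log 2 n ≤ n := Nat.pow_log_le_self 2 (by omega)
    have h2 := Nat.lt_two_pow_self (n := Nat.log 2 n)
    omega
  have hn2 : (n : ℝ) ≤ 2 ^ κ := by exact_mod_cast (Nat.lt_pow_succ_log_self (by norm_num) n).le
  have hκΛ : (κ : ℝ) ≤ 2 * Λ := by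
    have h1 : 2 ^ κ ≤ 2 * n := by
      rw [hκ, pow_succ']
      exact Nat.mul_le_mul_left 2 (Nat.pow_log_le_self 2 (by omega))
    have h2 : Real.log ((2 : ℝ) ^ κ) ≤ Λ :=
      Real.log_le_log (by positivity) (by exact_mod_cast h1)
    rw [Real.log_pow] at h2
    have := Real.log_two_gt_d9
    have h3 : (0 : ℝ) ≤ κ := by positivity
    nlinarith
  -- `5 * 4 ^ k * log (2 P)` pays for the number of links, as `4 ^ k + 4 ^ (k + 1) = 5 * 4 ^ k`, and
  -- `2 * log (2 n)` leaves a failure probability of order `n⁻²` for each of the `κ ≤ n` scales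
  let t (k : ℕ) : ℝ := √(2 * c * (5 * 4 ^ k * ℓ + 2 * Λ))
  have ht (k : ℕ) : 0 ≤ t k := Real.sqrt_nonneg _
  let Z (k : ℕ) : Finset (EuclideanSpace ℝ (Fin n)) :=
    (N k ×ˢ N (k + 1)).image fun v => G v.2 - G v.1
  have hZ (k : ℕ) : ((Z k).card : ℝ) ≤ (2 * Fintype.card ι) ^ (5 * 4 ^ k) := by
    have h : (Z k).card ≤ (2 * Fintype.card ι) ^ (5 * 4 ^ k) := by
      refine Finset.card_image_le.trans ?_
      rw [Finset.card_product]
      refine (Nat.mul_le_mul (hNcard k) (hNcard (k + 1))).trans_eq ?_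
      rw [← pow_add]
      congr 1
      ring
    exact_mod_cast h
  let link (k : ℕ) : Set Ω := ⋃ z ∈ Z k, {ω | t k * ‖z‖ < |∑ i, u i ω * z i|}
  let big : Set Ω := {ω | 2 * n ^ 2 * γ ^ 2 < ∑ i, u i ω ^ 2}
  have hlink (k : ℕ) : μ.real (link k) ≤ 1 / (2 * n ^ 2) := by
    refine (measureReal_iUnion_lt_abs_sum_le hind hu (Z k) (ht k)).trans ?_
    have hexp : Real.exp (-t k ^ 2 / (2 * c))
        = ((2 * Fintype.card ι : ℝ) ^ (5 * 4 ^ k))⁻¹ * ((2 * n : ℝ) ^ 2)⁻¹ := by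
      rw [Real.sq_sqrt (by positivity)]
      have h1 : -(2 * (c : ℝ) * (5 * 4 ^ k * ℓ + 2 * Λ)) / (2 * c)
          = -(((5 * 4 ^ k : ℕ) : ℝ) * ℓ) + -(((2 : ℕ) : ℝ) * Λ) := by
        push_cast
        field_simp
        ring
      rw [h1, Real.exp_add, Real.exp_neg, Real.exp_neg, Real.exp_nat_mul, Real.exp_nat_mul,
        Real.exp_log (by positivity), Real.exp_log (by positivity)]
    rw [hexp]
    calc _ ≤ (2 * Fintype.card ι : ℝ) ^ (5 * 4 ^ k) * (2 *
          (((2 * Fintype.card ι : ℝ) ^ (5 * 4 ^ k))⁻¹ * ((2 * n : ℝ) ^ 2)⁻¹)) :=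
          mul_le_mul_of_nonneg_right (hZ k) (by positivity)
      _ = 1 / (2 * n ^ 2) := by field_simp
  have hbig : μ.real big ≤ 1 / (2 * n) := by
    refine (measureReal_lt_sum_sq_le hint hv (by positivity)).trans_eq ?_
    field_simp
  refine ⟨((⋃ k ∈ Finset.range κ, link k) ∪ big)ᶜ, ?_, ?_, fun ω hω θ hθ => ?_⟩
  · refine (MeasurableSet.union (Finset.measurableSet_biUnion _ fun k _ =>
      Finset.measurableSet_biUnion _ fun z _ => ?_) ?_).compl
    · exact measurableSet_lt (by fun_prop) (by fun_prop)
    · exact measurableSet_lt (by fun_prop) (by fun_prop)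
  · have h1 : μ.real (⋃ k ∈ Finset.range κ, link k) ≤ 1 / (2 * n) := by
      refine (measureReal_biUnion_finset_le _ _).trans ?_
      refine (Finset.sum_le_card_nsmul _ _ _ fun k _ => hlink k).trans ?_
      rw [Finset.card_range, nsmul_eq_mul]
      have : (κ : ℝ) ≤ n := by exact_mod_cast hκn
      calc (κ : ℝ) * (1 / (2 * (n : ℝ) ^ 2)) ≤ n * (1 / (2 * n ^ 2)) := by gcongr
        _ = 1 / (2 * (n : ℝ)) := by field_simp
    have h2 := measureReal_union_le (μ := μ) (⋃ k ∈ Finset.range κ, link k) big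
    have h3 := measureReal_union_le (μ := μ) ((⋃ k ∈ Finset.range κ, link k) ∪ big)
      ((⋃ k ∈ Finset.range κ, link k) ∪ big)ᶜ
    rw [Set.union_compl_self, probReal_univ] at h3
    have h4 : 1 / (2 * (n : ℝ)) + 1 / (2 * n) = 1 / n := by field_simp; norm_num
    linarith
  · simp only [Set.mem_compl_iff, Set.mem_union, Set.mem_iUnion, not_or, not_exists, big, link,
      Set.mem_ofPred_eq, not_lt, Finset.mem_range] at hω
    obtain ⟨hω1, hω2⟩ := hω
    let φ : EuclideanSpace ℝ (Fin n) →+ ℝ :=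
      { toFun := fun z => ∑ i, u i ω * z i
        map_zero' := by simp
        map_add' := fun z z' => by simp [mul_add, Finset.sum_add_distrib] }
    have hφ (z) : |φ z| ≤ 2 * n * γ * ‖z‖ := by
      refine abs_le_of_sq_le_sq ?_ (by positivity)
      refine (Finset.sum_mul_sq_le_sq_mul_sq Finset.univ (fun i => u i ω) z.ofLp).trans ?_
      rw [mul_pow, EuclideanSpace.norm_sq_eq]
      simp only [Real.norm_eq_abs, sq_abs]
      refine mul_le_mul_of_nonneg_right (hω2.trans ?_) (by positivity)
      nlinarith [mul_pos (pow_pos hn0 2) (pow_pos hγ 2)]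
    have hchain := abs_apply_le_of_chain (κ := κ) (t := t) φ (by positivity) hM ht hG hG0 hN0 hNB
      hN (fun k hk v hv v' hv' => hω1 k hk (G v' - G v)
        (Finset.mem_image.2 ⟨(v, v'), Finset.mem_product.2 ⟨hv, hv'⟩, rfl⟩)) hφ hθ
    refine hchain.trans ?_
    have hs := sum_chain_le hc'.le hℓ1 hΛ1 hκΛ
    have hone : 1 ≤ √ℓ * Λ := one_le_mul_of_one_le_of_one_le (Real.one_le_sqrt.2 hℓ1) hΛ1
    have hr : 2 * n * γ * (2 / 2 ^ κ) ≤ 4 * γ * (√ℓ * Λ) := by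
      calc 2 * n * γ * (2 / 2 ^ κ) = 4 * γ * (n / 2 ^ κ) := by ring
        _ ≤ 4 * γ * (√ℓ * Λ) := by
          gcongr
          exact ((div_le_one (by positivity)).2 hn2).trans hone
    calc _ ≤ M * (30 * √(2 * c) * (√ℓ * Λ) + 4 * γ * (√ℓ * Λ)) := by gcongr
      _ = _ := by ring

end Chaining

end ScaleReg

/-! ### Lipschitz dependence of the network on its parameters -/

namespace ScaleReg

section Frobenius

variable {m n : Type*} [Fintype m] [Fintype n]

/-- The Frobenius norm of a matrix, as a plain number rather than through a norm instance. -/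
noncomputable def frob (M : Matrix m n ℝ) : ℝ := √(∑ k, ∑ j, M k j ^ 2)

lemma frob_nonneg (M : Matrix m n ℝ) : 0 ≤ frob M := Real.sqrt_nonneg _

lemma frob_sq (M : Matrix m n ℝ) : frob M ^ 2 = ∑ k, ∑ j, M k j ^ 2 :=
  Real.sq_sqrt (by positivity)

lemma frob_le_sum_abs (M : Matrix m n ℝ) : frob M ≤ ∑ k, ∑ j, |M k j| := by
  refine Real.sqrt_le_iff.2 ⟨by positivity, ?_⟩
  calc ∑ k, ∑ j, M k j ^ 2 ≤ ∑ k, (∑ j, |M k j|) ^ 2 := by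
        refine Finset.sum_le_sum fun k _ => ?_
        simpa using Finset.sum_sq_le_sq_sum_of_nonneg (s := Finset.univ) (f := fun j => |M k j|)
          fun j _ => abs_nonneg _
    _ ≤ _ := Finset.sum_sq_le_sq_sum_of_nonneg fun k _ => by positivity

lemma norm_mulVec_le (M : Matrix m n ℝ) (z : EuclideanSpace ℝ n) :
    ‖(WithLp.toLp 2 (M.mulVec (WithLp.ofLp z)) : EuclideanSpace ℝ m)‖ ≤ frob M * ‖z‖ := by
  refine le_of_sq_le_sq ?_ (mul_nonneg (frob_nonneg M) (norm_nonneg z))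
  rw [mul_pow, frob_sq, EuclideanSpace.norm_sq_eq, EuclideanSpace.norm_sq_eq, Finset.sum_mul]
  refine Finset.sum_le_sum fun k _ => ?_
  simp only [Real.norm_eq_abs, sq_abs]
  exact Finset.sum_mul_sq_le_sq_mul_sq _ _ _

lemma norm_mulVec_sub_mulVec_le (M N : Matrix m n ℝ) (z z' : EuclideanSpace ℝ n) :
    ‖(WithLp.toLp 2 (M.mulVec (WithLp.ofLp z)) : EuclideanSpace ℝ m)
        - WithLp.toLp 2 (N.mulVec (WithLp.ofLp z'))‖
      ≤ frob M * ‖z - z'‖ + frob (M - N) * ‖z'‖ := by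
  have h : (WithLp.toLp 2 (M.mulVec (WithLp.ofLp z)) : EuclideanSpace ℝ m)
        - WithLp.toLp 2 (N.mulVec (WithLp.ofLp z'))
      = WithLp.toLp 2 (M.mulVec (WithLp.ofLp (z - z')))
        + WithLp.toLp 2 ((M - N).mulVec (WithLp.ofLp z')) := by
    rw [← WithLp.toLp_add, ← WithLp.toLp_sub, WithLp.ofLp_sub, Matrix.mulVec_sub,
      Matrix.sub_mulVec]
    congr 1
    abel
  rw [h]
  exact (norm_add_le _ _).trans (add_le_add (norm_mulVec_le _ _) (norm_mulVec_le _ _))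

end Frobenius

section LeaveOneOut

/-- The leave-one-out sum `∑_{j<l} D j ∏_{i<l, i≠j} w i`, which is what the telescoping of a
difference of two `l`-fold compositions produces. -/
noncomputable def leaveOneOut (w D : ℕ → ℝ) (l : ℕ) : ℝ :=
  ∑ j ∈ Finset.range l, D j * ∏ i ∈ (Finset.range l).erase j, w i

lemma leaveOneOut_succ (w D : ℕ → ℝ) (l : ℕ) : leaveOneOut w D (l + 1) =
    w l * leaveOneOut w D l + D l * ∏ i ∈ Finset.range l, w i := by
  unfold leaveOneOut
  rw [Finset.sum_range_succ, Finset.mul_sum]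
  congr 1
  · refine Finset.sum_congr rfl fun j hj => ?_
    have hj' : j ≠ l := (Finset.mem_range.1 hj).ne
    rw [Finset.range_add_one, Finset.erase_insert_of_ne hj'.symm,
      Finset.prod_insert (by simp)]
    ring
  · rw [Finset.range_add_one, Finset.erase_insert (by simp)]

lemma prod_le_div_card_pow {s : Finset ℕ} {w : ℕ → ℝ} {S : ℝ} {L : ℕ} (hL : 1 ≤ L)
    (hs : s.card = L) (hw : ∀ i ∈ s, 0 ≤ w i) (hS : ∑ i ∈ s, w i ≤ S) :
    ∏ i ∈ s, w i ≤ (S / L) ^ L := by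
  have hL0 : (L : ℝ) ≠ 0 := by positivity
  have h := Real.geom_mean_le_arith_mean_weighted s (fun _ => (L : ℝ)⁻¹) w
    (fun _ _ => by positivity) (by simp [hs, hL0]) hw
  rw [Real.finsetProd_rpow s w hw, ← Finset.mul_sum] at h
  have hp : 0 ≤ ∏ i ∈ s, w i := Finset.prod_nonneg hw
  calc ∏ i ∈ s, w i = ((∏ i ∈ s, w i) ^ (L : ℝ)⁻¹) ^ L := by
        rw [← Real.rpow_natCast, ← Real.rpow_mul hp, inv_mul_cancel₀ hL0, Real.rpow_one]
    _ ≤ ((L : ℝ)⁻¹ * ∑ i ∈ s, w i) ^ L := by gcongr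
    _ ≤ (S / L) ^ L := by
        have := Finset.sum_nonneg hw
        rw [inv_mul_eq_div]
        gcongr

lemma leaveOneOut_le {w D : ℕ → ℝ} {S : ℝ} {L : ℕ} (hL : 1 ≤ L) (hw : ∀ i, 0 ≤ w i)
    (hD : ∀ i, 0 ≤ D i) (hS : ∑ i ∈ Finset.range (L + 1), w i ≤ S) :
    leaveOneOut w D (L + 1)
      ≤ (S / L) ^ L * (√((L : ℝ) + 1) * √(∑ j ∈ Finset.range (L + 1), D j ^ 2)) := by
  have hS0 : 0 ≤ S := (Finset.sum_nonneg fun i _ => hw i).trans hS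
  have h1 : leaveOneOut w D (L + 1) ≤ ∑ j ∈ Finset.range (L + 1), D j * (S / L) ^ L := by
    refine Finset.sum_le_sum fun j hj => mul_le_mul_of_nonneg_left ?_ (hD j)
    refine prod_le_div_card_pow hL (by simp [Finset.card_erase_of_mem hj]) (fun i _ => hw i)
      (le_trans ?_ hS)
    exact Finset.sum_le_sum_of_subset_of_nonneg (Finset.erase_subset _ _) fun i _ _ => hw i
  have h2 : ∑ j ∈ Finset.range (L + 1), D j
      ≤ √((L : ℝ) + 1) * √(∑ j ∈ Finset.range (L + 1), D j ^ 2) := by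
    rw [← Real.sqrt_mul (by positivity)]
    refine Real.le_sqrt_of_sq_le ?_
    simpa using sq_sum_le_card_mul_sum_sq (s := Finset.range (L + 1)) (f := D)
  rw [← Finset.sum_mul, mul_comm] at h1
  exact h1.trans (by gcongr)

end LeaveOneOut

namespace Architecture

variable {A : Architecture}

lemma norm_hidden_le {f : A.Activations} {c : ℝ} (hc : 0 ≤ c) (hf : LipschitzActivations f c)
    {W : A.Param} {w : ℕ → ℝ} (hW : ∀ l : Fin (A.L + 1), frob (W l) ≤ w l)
    (x : A.Layer 0) (l : ℕ) (hl : l ≤ A.L) :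
    ‖hidden f W x l hl‖ ≤ c ^ l * (∏ i ∈ Finset.range l, w i) * ‖x‖ := by
  induction l with
  | zero => simp [hidden]
  | succ l ih =>
    have ih := ih (by omega)
    have hWl := hW ⟨l, by omega⟩
    have hw : 0 ≤ w l := (frob_nonneg _).trans hWl
    obtain ⟨h0, hlip⟩ := hf (l + 1) (by omega) hl
    have h1 := hlip (WithLp.toLp 2 (Matrix.mulVec (W ⟨l, by omega⟩)
      (WithLp.ofLp (hidden f W x l (by omega))))) 0
    rw [h0, sub_zero, sub_zero] at h1
    rw [hidden]
    calc _ ≤ _ := h1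
      _ ≤ c * (w l * (c ^ l * (∏ i ∈ Finset.range l, w i) * ‖x‖)) := by
          gcongr
          exact (norm_mulVec_le _ _).trans (by gcongr)
      _ = _ := by rw [Finset.prod_range_succ]; ring

/-- The perturbation bound of one affine layer, given the bounds for its inputs. -/
lemma norm_mulVec_hidden_sub_le {f : A.Activations} {c : ℝ} (hc : 0 ≤ c)
    (hf : LipschitzActivations f c) {W V : A.Param} {w D : ℕ → ℝ}
    (hW : ∀ l : Fin (A.L + 1), frob (W l) ≤ w l) (hV : ∀ l : Fin (A.L + 1), frob (V l) ≤ w l)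
    (hD : ∀ l : Fin (A.L + 1), frob (W l - V l) ≤ D l) (x : A.Layer 0) (l : ℕ) (hl : l ≤ A.L)
    (ih : ‖hidden f W x l hl - hidden f V x l hl‖ ≤ c ^ l * leaveOneOut w D l * ‖x‖) :
    ‖(WithLp.toLp 2 (Matrix.mulVec (W ⟨l, by omega⟩) (WithLp.ofLp (hidden f W x l hl))) :
        A.Layer (l + 1))
      - WithLp.toLp 2 (Matrix.mulVec (V ⟨l, by omega⟩) (WithLp.ofLp (hidden f V x l hl)))‖
      ≤ c ^ l * leaveOneOut w D (l + 1) * ‖x‖ := by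
  have hWl := hW ⟨l, by omega⟩
  have hDl := hD ⟨l, by omega⟩
  have hw : 0 ≤ w l := (frob_nonneg _).trans hWl
  have hD0 : 0 ≤ D l := (frob_nonneg _).trans hDl
  calc _ ≤ _ := norm_mulVec_sub_mulVec_le _ _ _ _
    _ ≤ w l * (c ^ l * leaveOneOut w D l * ‖x‖)
        + D l * (c ^ l * (∏ i ∈ Finset.range l, w i) * ‖x‖) := by
        gcongr
        exact norm_hidden_le hc hf hV x l hl
    _ = _ := by rw [leaveOneOut_succ]; ring

lemma norm_hidden_sub_le {f : A.Activations} {c : ℝ} (hc : 0 ≤ c)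
    (hf : LipschitzActivations f c) {W V : A.Param} {w D : ℕ → ℝ}
    (hW : ∀ l : Fin (A.L + 1), frob (W l) ≤ w l) (hV : ∀ l : Fin (A.L + 1), frob (V l) ≤ w l)
    (hD : ∀ l : Fin (A.L + 1), frob (W l - V l) ≤ D l) (x : A.Layer 0) (l : ℕ) (hl : l ≤ A.L) :
    ‖hidden f W x l hl - hidden f V x l hl‖ ≤ c ^ l * leaveOneOut w D l * ‖x‖ := by
  induction l with
  | zero => simp [hidden, leaveOneOut]
  | succ l ih =>
    have h := norm_mulVec_hidden_sub_le hc hf hW hV hD x l (by omega) (ih (by omega))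
    rw [hidden, hidden]
    refine ((hf (l + 1) (by omega) hl).2 _ _).trans ?_
    rw [pow_succ', mul_assoc, mul_assoc]
    rw [mul_assoc] at h
    gcongr

lemma abs_net_sub_le {f : A.Activations} {c : ℝ} (hc : 0 ≤ c)
    (hf : LipschitzActivations f c) {W V : A.Param} {w D : ℕ → ℝ}
    (hW : ∀ l : Fin (A.L + 1), frob (W l) ≤ w l) (hV : ∀ l : Fin (A.L + 1), frob (V l) ≤ w l)
    (hD : ∀ l : Fin (A.L + 1), frob (W l - V l) ≤ D l) (x : A.Layer 0) :
    |net f W x - net f V x| ≤ c ^ A.L * leaveOneOut w D (A.L + 1) * ‖x‖ := by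
  refine le_trans ?_ (norm_mulVec_hidden_sub_le hc hf hW hV hD x A.L le_rfl
    (norm_hidden_sub_le hc hf hW hV hD x A.L le_rfl))
  have key (z z' : A.Layer (A.L + 1)) (k) : |z k - z' k| ≤ ‖z - z'‖ :=
    PiLp.norm_apply_le (z - z') k
  exact key
    (WithLp.toLp 2 (Matrix.mulVec (W ⟨A.L, by omega⟩) (WithLp.ofLp (hidden f W x A.L le_rfl))))
    (WithLp.toLp 2 (Matrix.mulVec (V ⟨A.L, by omega⟩) (WithLp.ofLp (hidden f V x A.L le_rfl))))
    ⟨0, A.p_pos (A.L + 1) le_rfl⟩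

/-- On the `ℓ₁` unit ball the network is Lipschitz in its parameters with respect to the Euclidean
norm. The factor `(2 / L)^L` is the arithmetic-geometric mean bound for a product of `L` layer
norms with total at most `2`, the sum of the `ℓ₁` norms of the two parameters. -/
lemma abs_net_sub_le_of_mem_unitBall {f : A.Activations} {c : ℝ} (hc : 0 ≤ c)
    (hf : LipschitzActivations f c) {W V : A.Param} (hW : W ∈ A.unitBall) (hV : V ∈ A.unitBall)
    (x : A.Layer 0) :
    |net f W x - net f V x| ≤ (2 * c / A.L) ^ A.L * ‖x‖ *
      (√((A.L : ℝ) + 1) * √(∑ l, frob (W l - V l) ^ 2)) := by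
  let e (U : A.Param) (l : Fin (A.L + 1)) : ℝ := ∑ k, ∑ j, |U l k j|
  have he (U : A.Param) (l) : 0 ≤ e U l := by positivity
  -- `w l` dominates the norm of either matrix, so it also bounds the mixed products
  let w (l : ℕ) : ℝ := if h : l < A.L + 1 then e W ⟨l, h⟩ + e V ⟨l, h⟩ else 0
  let D (l : ℕ) : ℝ := if h : l < A.L + 1 then frob (W ⟨l, h⟩ - V ⟨l, h⟩) else 0
  have hwv (l : Fin (A.L + 1)) : w l = e W l + e V l := dif_pos l.2
  have hDv (l : Fin (A.L + 1)) : D l = frob (W l - V l) := dif_pos l.2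
  have hw0 (l : ℕ) : 0 ≤ w l := by
    dsimp only [w]; split_ifs
    · exact add_nonneg (he _ _) (he _ _)
    · exact le_rfl
  have hD0 (l : ℕ) : 0 ≤ D l := by
    dsimp only [D]; split_ifs
    · exact frob_nonneg _
    · exact le_rfl
  have hsum : ∑ i ∈ Finset.range (A.L + 1), w i ≤ 2 := by
    rw [Finset.sum_range]
    simp only [hwv, Finset.sum_add_distrib]
    have h1 : ∑ l, e W l ≤ 1 := hW
    have h2 : ∑ l, e V l ≤ 1 := hV
    linarith
  have h1 := abs_net_sub_le hc hf (W := W) (V := V) (w := w) (D := D)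
    (fun l => (frob_le_sum_abs _).trans (by rw [hwv]; linarith [he V l]))
    (fun l => (frob_le_sum_abs _).trans (by rw [hwv]; linarith [he W l]))
    (fun l => (hDv l).ge) x
  have h2 := leaveOneOut_le A.one_le_L hw0 hD0 hsum
  rw [Finset.sum_range] at h2
  simp only [hDv] at h2
  calc _ ≤ _ := h1
    _ ≤ c ^ A.L * ((2 / A.L) ^ A.L * (√((A.L : ℝ) + 1) * √(∑ l, frob (W l - V l) ^ 2))) * ‖x‖ := by
        gcongr
    _ = _ := by rw [show 2 * c / (A.L : ℝ) = c * (2 / A.L) by ring, mul_pow]; ring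

/-- The positions of the entries of the weight matrices. -/
abbrev ParamIndex (A : Architecture) : Type :=
  Σ l : Fin (A.L + 1), Fin (A.p (l + 1)) × Fin (A.p l)

/-- The weight matrices with the given vector of entries. -/
def ofVec (θ : EuclideanSpace ℝ A.ParamIndex) : A.Param := fun l k j => θ ⟨l, k, j⟩

/-- The vector of all entries of the weight matrices. -/
def toVec (W : A.Param) : EuclideanSpace ℝ A.ParamIndex :=
  WithLp.toLp 2 fun i => W i.1 i.2.1 i.2.2

lemma card_paramIndex : Fintype.card A.ParamIndex = A.numParams := by
  simp [numParams, Finset.sum_range]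

lemma sum_paramIndex (φ : A.ParamIndex → ℝ) : ∑ i, φ i = ∑ l, ∑ k, ∑ j, φ ⟨l, k, j⟩ := by
  rw [Fintype.sum_sigma]
  exact Finset.sum_congr rfl fun l _ => Fintype.sum_prod_type _

lemma l1Norm_ofVec (θ : EuclideanSpace ℝ A.ParamIndex) : l1Norm (ofVec θ) = ∑ i, |θ i| := by
  rw [sum_paramIndex fun i => |θ i|]
  rfl

lemma sum_frob_ofVec_sub (θ θ' : EuclideanSpace ℝ A.ParamIndex) :
    ∑ l, frob (ofVec θ l - ofVec θ' l) ^ 2 = ‖θ - θ'‖ ^ 2 := by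
  rw [EuclideanSpace.norm_sq_eq, sum_paramIndex fun i => ‖(θ - θ') i‖ ^ 2]
  refine Finset.sum_congr rfl fun l _ => ?_
  rw [frob_sq]
  refine Finset.sum_congr rfl fun k _ => Finset.sum_congr rfl fun j _ => ?_
  rw [Real.norm_eq_abs, sq_abs]
  rfl

lemma two_le_numParams : 2 ≤ A.numParams := by
  have hL := A.one_le_L
  have h : ∑ _l ∈ Finset.range (A.L + 1), 1 ≤ A.numParams := by
    refine Finset.sum_le_sum fun l hl => ?_
    have := Finset.mem_range.1 hl
    exact Nat.mul_pos (A.p_pos _ (by omega)) (A.p_pos _ (by omega))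
  simp at h
  omega

lemma net_zero {f : A.Activations} (x : A.Layer 0) : net f 0 x = 0 := by
  simp [net]

end Architecture

end ScaleReg

/-! ### The oracle inequality -/

namespace ScaleReg

namespace Architecture

variable {A : Architecture}

lemma predErr_sq {n : ℕ} (x : Fin n → A.Layer 0) (gstar h : A.Layer 0 → ℝ) :
    predErr x gstar h ^ 2 = 1 / (n : ℝ) * ∑ i, (h (x i) - gstar (x i)) ^ 2 :=
  Real.sq_sqrt (by positivity)

/-- The network outputs at the data points, as a function of the vector of parameters. -/
noncomputable def outputs {n : ℕ} (f : A.Activations) (x : Fin n → A.Layer 0)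
    (θ : EuclideanSpace ℝ A.ParamIndex) : EuclideanSpace ℝ (Fin n) :=
  WithLp.toLp 2 fun i => net f (ofVec θ) (x i)

lemma outputs_zero {n : ℕ} (f : A.Activations) (x : Fin n → A.Layer 0) : outputs f x 0 = 0 := by
  ext i
  exact net_zero _

lemma norm_outputs_sub_le {n : ℕ} {f : A.Activations} {c : ℝ} (hc : 0 ≤ c)
    (hf : LipschitzActivations f c) (x : Fin n → A.Layer 0) (hn : 0 < n)
    {θ θ' : EuclideanSpace ℝ A.ParamIndex} (hθ : θ ∈ l1Ball A.ParamIndex)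
    (hθ' : θ' ∈ l1Ball A.ParamIndex) :
    ‖outputs f x θ - outputs f x θ'‖
      ≤ (2 * c / A.L) ^ A.L * √((A.L : ℝ) + 1) * (√n * dataNorm x) * ‖θ - θ'‖ := by
  have hW : ofVec θ ∈ A.unitBall := (l1Norm_ofVec θ).trans_le hθ
  have hW' : ofVec θ' ∈ A.unitBall := (l1Norm_ofVec θ').trans_le hθ'
  have hn' : (0 : ℝ) < n := by exact_mod_cast hn
  have hd : (√n * dataNorm x) ^ 2 = ∑ i, ‖x i‖ ^ 2 := by
    rw [dataNorm, mul_pow, Real.sq_sqrt hn'.le, Real.sq_sqrt (by positivity)]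
    field_simp
  refine le_of_sq_le_sq ?_ (by unfold dataNorm; positivity)
  rw [EuclideanSpace.norm_sq_eq, mul_pow, mul_pow _ (√n * dataNorm x), hd, Finset.mul_sum,
    Finset.sum_mul]
  refine Finset.sum_le_sum fun i _ => ?_
  have h := abs_net_sub_le_of_mem_unitBall hc hf hW hW' (x i)
  rw [sum_frob_ofVec_sub, Real.sqrt_sq (norm_nonneg _)] at h
  rw [← mul_pow, ← mul_pow]
  refine pow_le_pow_left₀ (norm_nonneg _) (h.trans_eq ?_) 2
  ring

/-- The basic inequality: if the empirical noise is dominated by `lam / 2` uniformly over the unit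
ball, then the estimate satisfies the oracle bound. -/
lemma predErr_sq_le_of_isEstimate {n : ℕ} {f : A.Activations} {x : Fin n → A.Layer 0}
    {gstar : A.Layer 0 → ℝ} {u y : Fin n → ℝ} {lam : ℝ} (hy : ∀ i, y i = gstar (x i) + u i)
    (hnoise : ∀ W ∈ A.unitBall, 2 / (n : ℝ) * |∑ i, u i * net f W (x i)| ≤ lam)
    {qhat q : ℝ × A.Param} (hqhat : IsEstimate f x y lam qhat) (hq : q ∈ A.scaleSpace) :
    predErr x gstar (scaledNet f qhat) ^ 2
      ≤ predErr x gstar (scaledNet f q) ^ 2 + 2 * lam * q.1 := by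
  have hmin : objective f x y lam qhat ≤ objective f x y lam q := hqhat.2 hq
  have hobj (p : ℝ × A.Param) : objective f x y lam p
      = predErr x gstar (scaledNet f p) ^ 2
        - p.1 * (2 / (n : ℝ) * ∑ i, u i * net f p.2 (x i))
        + 1 / (n : ℝ) * ∑ i, (2 * u i * gstar (x i) + u i ^ 2) + lam * p.1 := by
    rw [objective, predErr_sq]
    have : ∑ i, (y i - scaledNet f p (x i)) ^ 2
        = ∑ i, (scaledNet f p (x i) - gstar (x i)) ^ 2
          - 2 * p.1 * ∑ i, u i * net f p.2 (x i)
          + ∑ i, (2 * u i * gstar (x i) + u i ^ 2) := by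
      rw [Finset.mul_sum, ← Finset.sum_sub_distrib, ← Finset.sum_add_distrib]
      refine Finset.sum_congr rfl fun i _ => ?_
      rw [hy, scaledNet]
      ring
    rw [this]
    ring
  have hdev {p : ℝ × A.Param} (hp : p ∈ A.scaleSpace) :
      |p.1 * (2 / (n : ℝ) * ∑ i, u i * net f p.2 (x i))| ≤ p.1 * lam := by
    rw [abs_mul, abs_of_nonneg hp.1, abs_mul, abs_of_nonneg (by positivity : 0 ≤ 2 / (n : ℝ))]
    exact mul_le_mul_of_nonneg_left (hnoise _ hp.2) hp.1
  have h1 := (abs_le.1 (hdev hqhat.1)).2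
  have h2 := (abs_le.1 (hdev hq)).1
  rw [hobj, hobj] at hmin
  linarith

lemma zero_mem_scaleSpace : (0 : ℝ × A.Param) ∈ A.scaleSpace :=
  ⟨le_rfl, by simp [unitBall, l1Norm]⟩

end Architecture

end ScaleReg

theorem theorem2 (K γ : ℝ) (hK : 0 < K) (hγ : 0 < γ) :
    ∃ a : ℝ, 0 < a ∧ ∃ N : ℕ, ∀ n : ℕ, N ≤ n →
      ∀ (A : ScaleReg.Architecture) (f : A.Activations) (aLip : ℝ), 0 ≤ aLip →
      ScaleReg.Architecture.LipschitzActivations f aLip →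
      ∀ (x : Fin n → A.Layer 0) (gstar : A.Layer 0 → ℝ)
        (Ω : Type*) [MeasurableSpace Ω] (μ : Measure Ω) [IsProbabilityMeasure μ]
        (u y : Fin n → Ω → ℝ),
      ScaleReg.SubGaussianNoise μ K γ u →
      (∀ i ω, y i ω = gstar (x i) + u i ω) →
      ∀ lam : ℝ,
      a * (2 * aLip / (A.L : ℝ)) ^ A.L * ScaleReg.Architecture.dataNorm x
          * √((A.L : ℝ) * Real.log (2 * (A.numParams : ℝ)))
          * (Real.log (2 * (n : ℝ)) / √(n : ℝ)) ≤ lam →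
      ∃ E : Set Ω, MeasurableSet E ∧ 1 - 1 / (n : ℝ) ≤ μ.real E ∧
        ∀ ω ∈ E, ∀ qhat : ℝ × A.Param,
          ScaleReg.Architecture.IsEstimate f x (fun i => y i ω) lam qhat →
          ScaleReg.Architecture.predErr x gstar
              (ScaleReg.Architecture.scaledNet f qhat) ^ 2
            ≤ ⨅ q : A.scaleSpace,
                (ScaleReg.Architecture.predErr x gstar
                    (ScaleReg.Architecture.scaledNet f q.1) ^ 2
                  + 2 * lam * q.1.1) := by
  set c : NNReal := Real.toNNReal (K ^ 2 + 2 * γ ^ 2)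
  have hc : 0 < c := Real.toNNReal_pos.2 (by positivity)
  set b : ℝ := 30 * √(2 * c) + 4 * γ
  have hb0 : 0 < b := by positivity
  -- of the factor `4`, one `2` is that of `2 / n` and the other comes from `√(L + 1) ≤ 2 √L`
  refine ⟨4 * b, by positivity, 2, ?_⟩
  intro n hn A f aLip haLip hf x gstar Ω _ μ _ u y hu hy lam hlam
  have hn0 : (0 : ℝ) < n := by exact_mod_cast (by omega : 0 < n)
  obtain ⟨E, hE, hμE, hdev⟩ := ScaleReg.exists_event_abs_sum_le hn
    (ι := A.ParamIndex) (by
      rw [ScaleReg.Architecture.card_paramIndex]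
      exact ScaleReg.Architecture.two_le_numParams)
    (u := u) (c := c) (γ := γ) hc hγ hu.measurable hu.indep
    (fun i => ScaleReg.hasSubgaussianMGF_of_integral_exp_sq_le hK (hu.measurable i)
      (hu.centered i) (hu.integrable_exp i) (hu.bound i))
    (fun i => ScaleReg.integrable_sq_of_integrable_exp_sq hK (hu.measurable i)
      (hu.integrable_exp i))
    (fun i => ScaleReg.integral_sq_le_of_integral_exp_sq_le hK (hu.measurable i)
      (hu.integrable_exp i) (hu.bound i))
    (M := (2 * aLip / A.L) ^ A.L * √((A.L : ℝ) + 1) *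
      (√n * ScaleReg.Architecture.dataNorm x))
    (by unfold ScaleReg.Architecture.dataNorm; positivity)
    (fun θ hθ θ' hθ' => ScaleReg.Architecture.norm_outputs_sub_le haLip hf x (by omega) hθ hθ')
    (ScaleReg.Architecture.outputs_zero f x)
  refine ⟨E, hE, hμE, fun ω hω qhat hqhat => ?_⟩
  have : Nonempty A.scaleSpace := ⟨⟨0, ScaleReg.Architecture.zero_mem_scaleSpace⟩⟩
  refine le_ciInf fun q => ?_
  refine ScaleReg.Architecture.predErr_sq_le_of_isEstimate (fun i => hy i ω) (fun W hW => ?_)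
    hqhat q.2
  have h := hdev ω hω (ScaleReg.Architecture.toVec W)
    ((ScaleReg.Architecture.l1Norm_ofVec (ScaleReg.Architecture.toVec W)).ge.trans hW)
  rw [ScaleReg.Architecture.card_paramIndex] at h
  refine le_trans ?_ hlam
  refine (mul_le_mul_of_nonneg_left h (by positivity)).trans ?_
  have hL : (1 : ℝ) ≤ A.L := by exact_mod_cast A.one_le_L
  have hsL : √((A.L : ℝ) + 1) ≤ 2 * √(A.L : ℝ) := by
    refine Real.sqrt_le_iff.2 ⟨by positivity, ?_⟩
    rw [mul_pow, Real.sq_sqrt (by positivity)]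
    linarith
  have hlog : 0 ≤ Real.log (2 * (n : ℝ)) :=
    zero_le_one.trans (ScaleReg.one_le_log_two_mul (by exact_mod_cast hn))
  have hd : 0 ≤ ScaleReg.Architecture.dataNorm x := Real.sqrt_nonneg _
  rw [Real.sqrt_mul (by positivity : (0 : ℝ) ≤ A.L)]
  have hns : √(n : ℝ) / n = 1 / √(n : ℝ) := by rw [Real.sqrt_div_self, one_div]
  calc 2 / (n : ℝ) * (b * ((2 * aLip / A.L) ^ A.L * √((A.L : ℝ) + 1) *
        (√n * ScaleReg.Architecture.dataNorm x)) *
        (√(Real.log (2 * A.numParams)) * Real.log (2 * n)))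
      = 2 * b * (2 * aLip / A.L) ^ A.L * ScaleReg.Architecture.dataNorm x *
        (√((A.L : ℝ) + 1) * √(Real.log (2 * A.numParams))) *
        (Real.log (2 * n) * (√(n : ℝ) / n)) := by ring
    _ ≤ 2 * b * (2 * aLip / A.L) ^ A.L * ScaleReg.Architecture.dataNorm x *
        (2 * √(A.L : ℝ) * √(Real.log (2 * A.numParams))) *
        (Real.log (2 * n) * (√(n : ℝ) / n)) := by gcongr
    _ = _ := by rw [hns]; ring
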